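/- All graphs are finite, undirected, without loops or multiple edges. For a graph $G$ and a vertex $x$, the graph $G-x$ is called a card of $G$; the deck of $G$ is the multiset of the isomorphism classes of its cards; and $b(G,H)$ is the cardinality of the multiset intersection of the decks of $G$ and $H$. The skeleton of $G$ is obtained by deleting all leaves and isolated vertices of $G$. A sunshine graph is a connected graph whose skeleton is a cycle, and a caterpillar is a connected graph whose skeleton is a path (with at least one vertex). A supercard of $G$ and $H$ is a graph $G^+$ together with vertices $v,w$ of $G^+$ such that $G^+-w\cong G$ and $G^+-v\cong H$. For such a supercard let $B_{vw}(G^+)$ be the set of permutations $\lambda$ of $V(G^+)$ that map the graph $(G^+-w)-\lambda^{-1}(v)$ onto the graph $(G^+-v)-\lambda(w)$, and let $B^G_{vw}(G^+)$ be the set of those $\lambda\in B_{vw}(G^+)$ that map $G^+-w$ onto $G^+-\lambda(w)$. A maximum saturating set is a set $X\subseteq B_{vw}(G^+)$ such that (a) $X$ contains the identity; (b) $\lambda^{-1}(v)\ne\pi^{-1}(v)$ and $\lambda(w)\neq\pi(w)$ for all distinct $\lambda,\pi\in X$; and (c) there is no $\sigma\in B_{vw}(G^+)\setminus X$ such that $X\cup\{\sigma\}$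 satisfies (b). Let $\chi(G^+)$ (which is taken with respect to $v$ and $w$) be the largest value of $|X\cap B^G_{vw}(G^+)|$ over all maximum saturating sets $X$. **Theorem.** Let $U$ be a sunshine graph and $T$ a caterpillar. Let $U^+$ (with vertices $v,w$ such that $U^+-w\cong U$ and $U^+-v\cong T$) be a supercard of $U$ and $T$ that is a sunshine graph and that has the largest possible value of $\chi(U^+)$ over all supercards of $U$ and $T$ (with their vertices $v,w$) that are sunshine graphs. Then $$b(U,T)\le 2\chi(U^+)+5 .$$ -/

import Mathlib

universe u

namespace Supercards

/-- Isomorphism of graphs, as an equivalence relation on the graphs with vertex type in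
`Type u`. -/
def isoSetoid : Setoid (Σ V : Type u, SimpleGraph V) where
  r A B := Nonempty (A.2 ≃g B.2)
  iseqv :=
    { refl := fun _ => ⟨SimpleGraph.Iso.refl⟩
      symm := fun ⟨e⟩ => ⟨e.symm⟩
      trans := fun ⟨e⟩ ⟨f⟩ => ⟨e.trans f⟩ }

/-- Unlabelled graphs, i.e. isomorphism classes of graphs. -/
def UnlabelledGraph : Type (u + 1) := Quotient isoSetoid.{u}

/-- The card `G - x`: the subgraph induced on all the vertices other than `x`. -/
abbrev card {V : Type u} (G : SimpleGraph V) (x : V) : SimpleGraph ↥({x}ᶜ : Set V) :=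
  G.induce {x}ᶜ

/-- The unlabelled graph underlying `G`. -/
def unlabel {V : Type u} (G : SimpleGraph V) : UnlabelledGraph.{u} :=
  Quotient.mk isoSetoid ⟨V, G⟩

/-- The deck of `G`: the multiset of its unlabelled cards. -/
def deck {V : Type u} [Fintype V] (G : SimpleGraph V) : Multiset UnlabelledGraph.{u} :=
  (Finset.univ : Finset V).val.map fun x => unlabel (card G x)

open Classical in
/-- The number `b(G, H)` of common cards: the cardinality of the multiset intersection of the
decks. -/
noncomputable def commonCards {V V' : Type u} [Fintype V] [Fintype V']
    (G : SimpleGraph V) (H : SimpleGraph V') : ℕ :=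
  (deck G ∩ deck H).card

/-- The degree of a vertex (of a finite graph). -/
noncomputable def deg {V : Type u} (G : SimpleGraph V) (x : V) : ℕ :=
  (G.neighborSet x).ncard

/-- The skeleton of `G`: all leaves and isolated vertices are deleted. -/
abbrev skel {V : Type u} (G : SimpleGraph V) :
    SimpleGraph ↥({x | deg G x ≠ 0 ∧ deg G x ≠ 1} : Set V) :=
  G.induce {x | deg G x ≠ 0 ∧ deg G x ≠ 1}

/-- A sunshine graph: a connected graph whose skeleton is a cycle. -/
def IsSunshine {V : Type u} (G : SimpleGraph V) : Prop :=
  G.Connected ∧ ∃ c : ℕ, 3 ≤ c ∧ Nonempty (skel G ≃g SimpleGraph.cycleGraph c)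

/-- A caterpillar: a connected graph whose skeleton is a path (on at least one vertex). -/
def IsCaterpillar {V : Type u} (G : SimpleGraph V) : Prop :=
  G.Connected ∧ ∃ p : ℕ, 1 ≤ p ∧ Nonempty (skel G ≃g SimpleGraph.pathGraph p)

/-- `S` with the distinguished vertices `v` and `w` is a supercard of `G` and `H`:
`S - w ≅ G` and `S - v ≅ H`. -/
def IsSupercard {W V V' : Type u} (S : SimpleGraph W) (v w : W)
    (G : SimpleGraph V) (H : SimpleGraph V') : Prop :=
  Nonempty (card S w ≃g G) ∧ Nonempty (card S v ≃g H)

/-- The permutation `p` of the vertices of `S` maps the subgraph of `S` induced on `A` onto the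
subgraph of `S` induced on `B`. -/
def MapsOnto {W : Type u} (S : SimpleGraph W) (p : Equiv.Perm W) (A B : Set W) : Prop :=
  p '' A = B ∧ ∀ x ∈ A, ∀ y ∈ A, S.Adj x y ↔ S.Adj (p x) (p y)

/-- The active permutations of `S` with respect to `v` and `w`: those `p` with
`p ((S - w) - p⁻¹ v) = (S - v) - p w`. -/
def active {W : Type u} (S : SimpleGraph W) (v w : W) : Set (Equiv.Perm W) :=
  {p | MapsOnto S p ({w}ᶜ \ {p⁻¹ v}) ({v}ᶜ \ {p w})}

/-- The active permutations `p` that map the card `S - w` onto the card `S - p w`. -/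
def activeOnCard {W : Type u} (S : SimpleGraph W) (v w : W) : Set (Equiv.Perm W) :=
  {p | p ∈ active S v w ∧ MapsOnto S p {w}ᶜ {p w}ᶜ}

/-- Distinct permutations in `X` have different values of `p⁻¹ v` and different values of
`p w`. -/
def Separated {W : Type u} (v w : W) (X : Set (Equiv.Perm W)) : Prop :=
  ∀ p ∈ X, ∀ q ∈ X, p ≠ q → p⁻¹ v ≠ q⁻¹ v ∧ p w ≠ q w

/-- Maximum saturating sets of the set of active permutations with respect to `v` and `w`. -/
structure IsMaxSaturating {W : Type u} (S : SimpleGraph W) (v w : W)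
    (X : Set (Equiv.Perm W)) : Prop where
  subset_active : X ⊆ active S v w
  one_mem : (1 : Equiv.Perm W) ∈ X
  separated : Separated v w X
  maximal : ∀ s ∈ active S v w \ X, ¬ Separated v w (X ∪ {s})

/-- `χ(S)`, for the supercard `S` with distinguished vertices `v` and `w`: the largest number of
elements of a maximum saturating set that map the card `S - w` onto a card of `S`. For finite `S`
the set of natural numbers below is non-empty and bounded. -/
noncomputable def chi {W : Type u} (S : SimpleGraph W) (v w : W) : ℕ :=
  sSup {k | ∃ X, IsMaxSaturating S v w X ∧ (X ∩ activeOnCard S v w).ncard = k}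

end Supercards

/-! Match `b(U,T)` vertices `x` of `U` injectively with vertices `y` of `T` so that `U - x ≅ T - y`.
Let `s`, `t` be the ends of the skeleton of `T`, with distinct leaves `a`, `b` attached to them. At
most four pairs have `y` in `{s, t, a, b}`; consider any other pair.

Since `T` has no cycle, `x` lies on the cycle of `U`. Counting edges gives `deg y < deg x`, which
rules out inner skeleton vertices, so `y` is a leaf (`AgreesOff.not_isCore_right`), and then `x` has
no leaves and degree 2. Restoring both deleted vertices to the common card gives `T` plus a new
vertex of degree 2, in which the new vertex plays the role of `x` and `y` is a pendant vertex. This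
graph is `join T c d`; it is a sunshine graph and a supercard of `U` and `T`.

The new vertex must close the path of `T` into a cycle, so `c` and `d` are, up to order, ends of the
path or leaves at those ends (`IsEnds.isNear`). Leaves at one vertex are interchangeable, so only
four choices remain: `s` or `a` with `t` or `b`. The length of the cycle of `U` leaves at most two
of them (`exists_two_joins`).

For a fixed join, every pair identifies `U` with a card of the same graph. Comparing these
identifications with a fixed one yields separated active permutations that map a card onto a card,
so each join accounts for at most `χ` pairs (`card_le_of_aligned`). The total is at most `2χ + 4`.
-/

namespace Supercards

/-! ### Lower bounds for `chi` -/

section Chi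

variable {V W : Type u}

/-- `E` identifies the graph `U` with the card of `S` at `E none`. -/
def IsCardEquiv (U : SimpleGraph V) (S : SimpleGraph W) (E : Option V ≃ W) : Prop :=
  ∀ a b, U.Adj a b ↔ S.Adj (E (some a)) (E (some b))

theorem IsCardEquiv.nonempty_iso {U : SimpleGraph V} {S : SimpleGraph W} {E : Option V ≃ W}
    (h : IsCardEquiv U S E) {y : W} (hy : E none = y) : Nonempty (card S y ≃g U) := by
  subst hy
  have key : ∀ a : V, E (some a) ∈ ({E none}ᶜ : Set W) := fun a => by simp
  let f : V → ↥({E none}ᶜ : Set W) := fun a => ⟨E (some a), key a⟩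
  have hf : Function.Bijective f := by
    constructor
    · intro a b hab
      have := congrArg Subtype.val hab
      simpa [f] using this
    · rintro ⟨b, hb⟩
      obtain ⟨a, rfl⟩ := E.surjective b
      cases a with
      | none => exact absurd rfl hb
      | some a => exact ⟨a, rfl⟩
  refine ⟨SimpleGraph.Iso.symm ⟨Equiv.ofBijective f hf, ?_⟩⟩
  intro a b
  exact (h a b).symm

/-- By finiteness `Y` extends to an inclusion-maximal separated set of active permutations, which is
a maximum saturating set because it contains the identity. -/
theorem card_le_chi [Finite W] {S : SimpleGraph W} {v w : W} {Y : Set (Equiv.Perm W)}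
    (hY : Y ⊆ activeOnCard S v w) (h1 : (1 : Equiv.Perm W) ∈ Y) (hsep : Separated v w Y) :
    Y.ncard ≤ chi S v w := by
  obtain ⟨X, hYX, hX⟩ := Finite.exists_le_maximal
    (p := fun X : Set (Equiv.Perm W) => X ⊆ active S v w ∧ Separated v w X)
    (a := Y) ⟨fun p hp => (hY hp).1, hsep⟩
  have hXs : IsMaxSaturating S v w X :=
    { subset_active := hX.prop.1
      one_mem := hYX h1
      separated := hX.prop.2
      maximal := fun s hs hsep' => hs.2 <|
        hX.le_of_ge ⟨Set.union_subset hX.prop.1 (by simpa using hs.1), hsep'⟩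
          Set.subset_union_left (Set.mem_union_right _ rfl) }
  calc Y.ncard ≤ (X ∩ activeOnCard S v w).ncard :=
        Set.ncard_le_ncard (Set.subset_inter hYX hY) (Set.toFinite _)
    _ ≤ chi S v w := le_csSup
        ⟨Nat.card (Equiv.Perm W), by
          rintro _ ⟨X, -, rfl⟩
          exact Set.ncard_le_card _⟩
        ⟨X, hXs, rfl⟩

theorem IsCardEquiv.symm_trans_mem_activeOnCard {U : SimpleGraph V} {S : SimpleGraph W}
    {E F : Option V ≃ W} (hE : IsCardEquiv U S E) (hF : IsCardEquiv U S F) {v w : W}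
    (hw : E none = w) :
    E.symm.trans F ∈ activeOnCard S v w := by
  have hadj : ∀ a ∈ ({w}ᶜ : Set W), ∀ b ∈ ({w}ᶜ : Set W),
      S.Adj a b ↔ S.Adj ((E.symm.trans F) a) ((E.symm.trans F) b) := by
    intro a ha b hb
    obtain ⟨a, rfl⟩ := E.surjective a
    obtain ⟨b, rfl⟩ := E.surjective b
    cases a with
    | none => exact absurd hw ha
    | some a =>
      cases b with
      | none => exact absurd hw hb
      | some b => simp [← hE a b, ← hF a b]
  refine ⟨⟨?_, fun a ha b hb => hadj a ha.1 b hb.1⟩, ?_, hadj⟩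
  · rw [Set.image_sdiff (Equiv.injective _), Set.image_compl_eq (Equiv.bijective _),
      Set.image_singleton, Set.image_singleton]
    ext; simp [and_comm]
  · rw [Set.image_compl_eq (Equiv.bijective _), Set.image_singleton]

/-- A pair `(x, y)` stands for an identification of `U` with the card at `y` in which `x` becomes
`v`. Injectivity in `x` separates the values of `λ⁻¹ v`, and injectivity in `y` those of `λ w`. -/
theorem card_le_chi_of_isCardEquiv [Finite W] {U : SimpleGraph V} {S : SimpleGraph W} {v : W}
    (P : Finset (V × W)) (h₁ : Set.InjOn Prod.fst (P : Set (V × W)))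
    (h₂ : Set.InjOn Prod.snd (P : Set (V × W)))
    (hP : ∀ p ∈ P, ∃ E : Option V ≃ W, E none = p.2 ∧ E (some p.1) = v ∧ IsCardEquiv U S E)
    {p₀ : V × W} (hp₀ : p₀ ∈ P) : P.card ≤ chi S v p₀.2 := by
  have : Nonempty (Option V ≃ W) := ⟨(hP p₀ hp₀).choose⟩
  choose! E hE₁ hE₂ hE₃ using hP
  -- Relative to the base pair `p₀`, which itself yields the identity.
  let g : V × W → Equiv.Perm W := fun p => (E p₀).symm.trans (E p)
  have hg : ∀ p, g p p₀.2 = E p none := fun p => by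
    simp only [g, Equiv.trans_apply]
    rw [← hE₁ p₀ hp₀, Equiv.symm_apply_apply]
  have hginv : ∀ p ∈ P, (g p)⁻¹ v = E p₀ (some p.1) := fun p hp => by
    rw [Equiv.Perm.inv_eq_iff_eq]
    simp [g, hE₂ p hp]
  have hinj : Set.InjOn g P := by
    intro p hp q hq hpq
    refine h₂ hp hq ?_
    have := hg p
    rw [hpq, hg q, hE₁ p hp, hE₁ q hq] at this
    exact this.symm
  have := card_le_chi (S := S) (v := v) (w := p₀.2) (Y := g '' P) ?_ ?_ ?_
  · rwa [hinj.ncard_image, Set.ncard_coe_finset] at this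
  · rintro _ ⟨p, hp, rfl⟩
    exact (hE₃ p₀ hp₀).symm_trans_mem_activeOnCard (hE₃ p hp) (hE₁ p₀ hp₀)
  · exact ⟨p₀, hp₀, by ext; simp [g]⟩
  · rintro _ ⟨p, hp, rfl⟩ _ ⟨q, hq, rfl⟩ hpq
    have hne : p ≠ q := fun h => hpq (h ▸ rfl)
    refine ⟨?_, ?_⟩
    · rw [hginv p hp, hginv q hq]
      simpa using fun h => hne (h₁ hp hq h)
    · rw [hg, hg, hE₁ p hp, hE₁ q hq]
      exact fun h => hne (h₂ hp hq h)

end Chi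

/-! ### Common cards as a matching of vertices -/

section Matching

theorem exists_matching_of_map_eq {α β γ : Type*} {f : α → γ} {g : β → γ} {s : Multiset α}
    {t : Multiset β} (h : s.map f = t.map g) :
    ∃ m : Multiset (α × β), m.map Prod.fst = s ∧ m.map Prod.snd = t ∧
      ∀ p ∈ m, f p.1 = g p.2 := by
  have hrel : Multiset.Rel (fun a b => f a = g b) s t := by
    rw [← Multiset.rel_eq, Multiset.rel_map] at h
    exact h
  clear h
  induction hrel with
  | zero => exact ⟨0, by simp⟩
  | @cons a b as bs hab _ ih =>
    obtain ⟨m, rfl, rfl, hm⟩ := ih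
    exact ⟨(a, b) ::ₘ m, by simp, by simp, by simpa [hab] using hm⟩

theorem exists_le_map_eq {α γ : Type*} {f : α → γ} {s : Multiset α} {t : Multiset γ}
    (h : t ≤ s.map f) : ∃ s' ≤ s, s'.map f = t := by
  classical
  induction s using Multiset.induction_on generalizing t with
  | empty => exact ⟨0, le_rfl, by simpa [eq_comm] using h⟩
  | cons a s ih =>
    by_cases ha : f a ∈ t
    · obtain ⟨t, rfl⟩ := Multiset.exists_cons_of_mem ha
      rw [Multiset.map_cons, Multiset.cons_le_cons_iff] at h
      obtain ⟨s', hs', rfl⟩ := ih h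
      exact ⟨a ::ₘ s', (Multiset.cons_le_cons_iff _).2 hs', by simp⟩
    · rw [Multiset.map_cons, Multiset.le_cons_of_notMem ha] at h
      obtain ⟨s', hs', rfl⟩ := ih h
      exact ⟨s', hs'.trans (Multiset.le_cons_self _ _), rfl⟩

theorem exists_matching {V V' : Type u} [Fintype V] [Fintype V']
    (G : SimpleGraph V) (H : SimpleGraph V') :
    ∃ M : Finset (V × V'), M.card = commonCards G H ∧
      Set.InjOn Prod.fst (M : Set (V × V')) ∧ Set.InjOn Prod.snd (M : Set (V × V')) ∧
      ∀ p ∈ M, Nonempty (card G p.1 ≃g card H p.2) := by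
  classical
  obtain ⟨s, hs, hs'⟩ := exists_le_map_eq
    (show deck G ∩ deck H ≤ (Finset.univ : Finset V).val.map _ from Multiset.inter_le_left)
  obtain ⟨t, ht, ht'⟩ := exists_le_map_eq
    (show deck G ∩ deck H ≤ (Finset.univ : Finset V').val.map _ from Multiset.inter_le_right)
  obtain ⟨m, rfl, rfl, hm⟩ := exists_matching_of_map_eq (hs'.trans ht'.symm)
  have h₁ : (m.map Prod.fst).Nodup := Multiset.nodup_of_le hs Finset.univ.nodup
  have h₂ : (m.map Prod.snd).Nodup := Multiset.nodup_of_le ht Finset.univ.nodup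
  refine ⟨⟨m, h₁.of_map _⟩, ?_, ?_, ?_, fun p hp => Quotient.exact (hm p hp)⟩
  · have := congrArg Multiset.card hs'
    rw [Multiset.card_map, Multiset.card_map] at this
    rw [Finset.card_mk, this, commonCards]
  · exact fun p hp q hq h => Multiset.inj_on_of_nodup_map h₁ p hp q hq h
  · exact fun p hp q hq h => Multiset.inj_on_of_nodup_map h₂ p hp q hq h

end Matching

/-! ### Skeleton vertices and sunshine graphs -/

section Core

variable {V : Type u}

/-- The vertex `x` belongs to the skeleton of `G`. -/
def IsCore (G : SimpleGraph V) (x : V) : Prop :=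
  ∃ b c, b ≠ c ∧ G.Adj x b ∧ G.Adj x c

theorem mem_skel_iff [Finite V] {G : SimpleGraph V} {x : V} :
    (deg G x ≠ 0 ∧ deg G x ≠ 1) ↔ IsCore G x := by
  have h : (deg G x ≠ 0 ∧ deg G x ≠ 1) ↔ 1 < deg G x := by omega
  rw [h, deg, Set.one_lt_ncard_iff (Set.toFinite _)]
  constructor
  · rintro ⟨a, b, ha, hb, hab⟩
    exact ⟨a, b, hab, ha, hb⟩
  · rintro ⟨a, b, hab, ha, hb⟩
    exact ⟨a, b, ha, hb, hab⟩

theorem eq_of_not_isCore {G : SimpleGraph V} {x a b : V} (h : ¬ IsCore G x) (ha : G.Adj x a)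
    (hb : G.Adj x b) : a = b := by
  by_contra hab
  exact h ⟨a, b, hab, ha, hb⟩

theorem mem_of_reachable {G : SimpleGraph V} {A : Set V} (hA : ∀ a ∈ A, ∀ b, G.Adj a b → b ∈ A)
    {x y : V} (h : G.Reachable x y) (hx : x ∈ A) : y ∈ A := by
  obtain ⟨p⟩ := h
  induction p with
  | nil => exact hx
  | cons hadj _ ih => exact ih (hA _ hx _ hadj)

/-- Two adjacent vertices outside the skeleton would form a whole component. -/
theorem isCore_of_adj {G : SimpleGraph V} (hG : G.Connected) (hs : ∃ s, IsCore G s) {x z : V}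
    (hx : ¬ IsCore G x) (hxz : G.Adj x z) : IsCore G z := by
  by_contra hz
  obtain ⟨s, hs⟩ := hs
  have := mem_of_reachable (A := {x, z}) (fun a ha b hab => by
    rcases ha with rfl | rfl
    · exact Or.inr (eq_of_not_isCore hx hab hxz)
    · exact Or.inl (eq_of_not_isCore hz hab hxz.symm)) (hG x s) (Or.inl rfl)
  rcases this with rfl | rfl
  · exact hx hs
  · exact hz hs

theorem exists_adj {G : SimpleGraph V} (hG : G.Connected) (hs : ∃ s, IsCore G s) (x : V) :
    ∃ z, G.Adj x z := by
  by_contra! h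
  obtain ⟨s, hs⟩ := hs
  have := mem_of_reachable (A := {x}) (fun a ha b hab => by
    rw [Set.mem_singleton_iff.1 ha] at hab
    exact absurd hab (h b)) (hG x s) rfl
  rw [Set.mem_singleton_iff.1 this] at hs
  obtain ⟨b, -, -, hb, -⟩ := hs
  exact h b hb

theorem IsSunshine.exists_isCore [Finite V] {G : SimpleGraph V} (h : IsSunshine G) :
    ∃ s, IsCore G s := by
  obtain ⟨-, c, hc, ⟨f⟩⟩ := h
  exact ⟨_, mem_skel_iff.1 (f.symm ⟨0, by omega⟩).2⟩

theorem cycleGraph_exists_neighbors {c : ℕ} (hc : 3 ≤ c) (i : Fin c) :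
    ∃ j k, j ≠ k ∧ ∀ l, (SimpleGraph.cycleGraph c).Adj i l ↔ l = j ∨ l = k := by
  obtain ⟨n, rfl⟩ := Nat.exists_eq_add_of_le' hc
  refine ⟨i - 1, i + 1, ?_, fun l => ?_⟩
  · intro h
    have := SimpleGraph.cycleGraph_degree_three_le (n := n) (v := i)
    rw [SimpleGraph.cycleGraph_degree_two_le, h] at this
    simp at this
  · rw [← SimpleGraph.mem_neighborSet, SimpleGraph.cycleGraph_neighborSet]
    simp

theorem IsSunshine.exists_neighbors [Finite V] {G : SimpleGraph V} (h : IsSunshine G) {x : V}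
    (hx : IsCore G x) : ∃ p q, p ≠ q ∧ IsCore G p ∧ IsCore G q ∧ G.Adj x p ∧ G.Adj x q ∧
      ∀ r, IsCore G r → G.Adj x r → r = p ∨ r = q := by
  obtain ⟨-, c, hc, ⟨f⟩⟩ := h
  have hx' := mem_skel_iff.2 hx
  obtain ⟨j, k, hjk, hl⟩ := cycleGraph_exists_neighbors hc (f ⟨x, hx'⟩)
  have hadj : ∀ l, (l = j ∨ l = k) → G.Adj x (f.symm l) := fun l h => by
    have : (skel G).Adj ⟨x, hx'⟩ (f.symm l) := by
      rw [← f.map_adj_iff, RelIso.apply_symm_apply]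
      exact (hl l).2 h
    exact this
  refine ⟨f.symm j, f.symm k, ?_, mem_skel_iff.1 (f.symm j).2, mem_skel_iff.1 (f.symm k).2,
    hadj j (Or.inl rfl), hadj k (Or.inr rfl), fun r hr hxr => ?_⟩
  · intro h
    exact hjk (f.symm.injective (Subtype.ext h))
  · have h' : (skel G).Adj ⟨x, hx'⟩ ⟨r, mem_skel_iff.2 hr⟩ := hxr
    rw [← f.map_adj_iff] at h'
    rcases (hl _).1 h' with h | h
    · left; rw [← h]; simp
    · right; rw [← h]; simp

theorem IsSunshine.not_isAcyclic {G : SimpleGraph V} (h : IsSunshine G) : ¬ G.IsAcyclic := by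
  obtain ⟨-, c, hc, ⟨f⟩⟩ := h
  intro hac
  exact SimpleGraph.isAcyclic_iff_free_cycleGraph.1 (hac.induce _) c hc ⟨f.symm.toCopy⟩

theorem IsSunshine.card_le_edges [Fintype V] {G : SimpleGraph V} (h : IsSunshine G) :
    Nat.card V ≤ Nat.card G.edgeSet := by
  have h1 := h.1.card_vert_le_card_edgeSet_add_one
  by_contra hlt
  exact h.not_isAcyclic (SimpleGraph.isTree_iff_connected_and_card.2 ⟨h.1, by omega⟩).isAcyclic

end Core

/-! ### Caterpillars and the ends of their skeletons -/

section Caterpillar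

variable {V : Type u}

theorem IsCaterpillar.exists_isCore [Finite V] {T : SimpleGraph V} (h : IsCaterpillar T) :
    ∃ s, IsCore T s := by
  obtain ⟨-, c, hc, ⟨f⟩⟩ := h
  exact ⟨_, mem_skel_iff.1 (f.symm ⟨0, by omega⟩).2⟩

/-- Every nonempty set of vertices has a member with at most one neighbour in the set. -/
theorem IsCaterpillar.not_two_neighbors [Finite V] {T : SimpleGraph V} (h : IsCaterpillar T)
    {A : Set V} (hA : A.Nonempty)
    (hA' : ∀ a ∈ A, ∃ b ∈ A, ∃ c ∈ A, b ≠ c ∧ T.Adj a b ∧ T.Adj a c) : False := by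
  obtain ⟨-, m, -, ⟨f⟩⟩ := h
  have hcore : ∀ a ∈ A, deg T a ≠ 0 ∧ deg T a ≠ 1 := fun a ha => by
    obtain ⟨b, -, c, -, hbc, hb, hc⟩ := hA' a ha
    exact mem_skel_iff.2 ⟨b, c, hbc, hb, hc⟩
  let g : A → Fin m := fun a => f ⟨a.1, hcore a.1 a.2⟩
  have : Nonempty A := hA.to_subtype
  -- At the member of `A` in the lowest position on the path, both neighbours in `A` would occupy
  -- the next position.
  obtain ⟨a, ha⟩ := Finite.exists_min g
  obtain ⟨b, hbA, c, hcA, hbc, hb, hc⟩ := hA' a a.2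
  have key : ∀ d (hd : d ∈ A), T.Adj a d → (g ⟨d, hd⟩ : ℕ) = g a + 1 := fun d hd had => by
    have h' : (skel T).Adj ⟨a.1, hcore a.1 a.2⟩ ⟨d, hcore d hd⟩ := had
    rw [← f.map_adj_iff, SimpleGraph.pathGraph_adj] at h'
    have := Fin.le_def.1 (ha ⟨d, hd⟩)
    simp only [g] at this ⊢
    omega
  apply hbc
  have : g ⟨b, hbA⟩ = g ⟨c, hcA⟩ := Fin.ext ((key b hbA hb).trans (key c hcA hc).symm)
  have := f.injective this
  exact congrArg Subtype.val this

theorem IsCaterpillar.isAcyclic [Finite V] {T : SimpleGraph V} (h : IsCaterpillar T) :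
    T.IsAcyclic := by
  rw [SimpleGraph.isAcyclic_iff_free_cycleGraph]
  rintro n hn ⟨f⟩
  refine h.not_two_neighbors (A := Set.range f) ⟨f ⟨0, by omega⟩, Set.mem_range_self _⟩ ?_
  rintro _ ⟨i, rfl⟩
  obtain ⟨j, k, hjk, hl⟩ := cycleGraph_exists_neighbors hn i
  exact ⟨f j, Set.mem_range_self _, f k, Set.mem_range_self _, fun h => hjk (f.injective h),
    f.toHom.map_adj ((hl j).2 (Or.inl rfl)), f.toHom.map_adj ((hl k).2 (Or.inr rfl))⟩

theorem IsCaterpillar.card_edges [Fintype V] {T : SimpleGraph V} (h : IsCaterpillar T) :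
    Nat.card T.edgeSet + 1 = Nat.card V :=
  (SimpleGraph.isTree_iff_connected_and_card.1 ⟨h.1, h.isAcyclic⟩).2

/-- `s` and `t` are the ends of the skeleton of `T`, and `a` and `b` are distinct leaves that are
adjacent to `s` and `t`, respectively. -/
structure IsEnds (T : SimpleGraph V) (s t a b : V) : Prop where
  core_left : IsCore T s
  core_right : IsCore T t
  left : ∀ p q, IsCore T p → IsCore T q → T.Adj s p → T.Adj s q → p = q
  right : ∀ p q, IsCore T p → IsCore T q → T.Adj t p → T.Adj t q → p = q
  eq_of_eq : s = t → ∀ p, IsCore T p → p = s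
  inner : ∀ p, IsCore T p → p ≠ s → p ≠ t →
    ∃ q r, q ≠ r ∧ IsCore T q ∧ IsCore T r ∧ T.Adj p q ∧ T.Adj p r
  exists_left : s ≠ t → ∃ p, IsCore T p ∧ T.Adj s p
  exists_right : s ≠ t → ∃ p, IsCore T p ∧ T.Adj t p
  leaf_left : ¬ IsCore T a
  leaf_right : ¬ IsCore T b
  adj_left : T.Adj s a
  adj_right : T.Adj t b
  ne : a ≠ b

theorem exists_leaf_of_unique {T : SimpleGraph V} {s : V} (hs : IsCore T s)
    (hu : ∀ p q, IsCore T p → IsCore T q → T.Adj s p → T.Adj s q → p = q) :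
    ∃ a, ¬ IsCore T a ∧ T.Adj s a := by
  obtain ⟨b, c, hbc, hb, hc⟩ := hs
  by_contra! h
  have hb' : IsCore T b := by by_contra hb'; exact h b hb' hb
  have hc' : IsCore T c := by by_contra hc'; exact h c hc' hc
  exact hbc (hu b c hb' hc' hb hc)

theorem IsCaterpillar.exists_isEnds [Finite V] {T : SimpleGraph V} (h : IsCaterpillar T) :
    ∃ s t a b, IsEnds T s t a b := by
  obtain ⟨-, m, hm, ⟨f⟩⟩ := h
  let g : Fin m → V := fun i => f.symm i
  have hg : ∀ i, IsCore T (g i) := fun i => mem_skel_iff.1 (f.symm i).2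
  have hinj : Function.Injective g := fun i j hij => f.symm.injective (Subtype.ext hij)
  have hsurj : ∀ p, IsCore T p → ∃ i, g i = p := fun p hp =>
    ⟨f ⟨p, mem_skel_iff.2 hp⟩, by simp [g]⟩
  have hadj : ∀ i j, T.Adj (g i) (g j) ↔ (i.val + 1 = j.val ∨ j.val + 1 = i.val) := fun i j => by
    rw [← SimpleGraph.pathGraph_adj, ← f.symm.map_adj_iff]
    rfl
  let i₀ : Fin m := ⟨0, by omega⟩
  let i₁ : Fin m := ⟨m - 1, by omega⟩
  have hleft : ∀ p q, IsCore T p → IsCore T q → T.Adj (g i₀) p → T.Adj (g i₀) q → p = q := by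
    intro p q hp hq hap haq
    obtain ⟨i, rfl⟩ := hsurj p hp
    obtain ⟨j, rfl⟩ := hsurj q hq
    rw [hadj] at hap haq
    congr 1
    ext
    simp only [i₀] at hap haq
    omega
  have hright : ∀ p q, IsCore T p → IsCore T q → T.Adj (g i₁) p → T.Adj (g i₁) q → p = q := by
    intro p q hp hq hap haq
    obtain ⟨i, rfl⟩ := hsurj p hp
    obtain ⟨j, rfl⟩ := hsurj q hq
    rw [hadj] at hap haq
    congr 1
    ext
    simp only [i₁] at hap haq
    omega
  have hone : g i₀ = g i₁ → m = 1 := fun h => by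
    have := congrArg Fin.val (hinj h)
    simp only [i₀, i₁] at this
    omega
  have heq : g i₀ = g i₁ → ∀ p, IsCore T p → p = g i₀ := by
    intro h p hp
    obtain ⟨i, rfl⟩ := hsurj p hp
    congr 1
    ext
    have := hone h
    simp only [i₀]
    omega
  have hlt : g i₀ ≠ g i₁ → 2 ≤ m := fun h => by
    by_contra hm'
    exact h (congrArg g (Fin.ext (by simp only [i₀, i₁]; omega)))
  have hab : ∃ a b, ¬ IsCore T a ∧ T.Adj (g i₀) a ∧ ¬ IsCore T b ∧ T.Adj (g i₁) b ∧ a ≠ b := by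
    -- If the ends coincide then `T` is a star, and two neighbours of its centre serve as leaves.
    by_cases hst : g i₀ = g i₁
    · obtain ⟨a, b, hab, ha, hb⟩ := hg i₀
      have hn : ∀ a, T.Adj (g i₀) a → ¬ IsCore T a := fun a ha hc => by
        rw [heq hst a hc] at ha
        exact T.irrefl ha
      exact ⟨a, b, hn a ha, ha, hn b hb, hst ▸ hb, hab⟩
    · obtain ⟨a, ha, ha'⟩ := exists_leaf_of_unique (hg i₀) hleft
      obtain ⟨b, hb, hb'⟩ := exists_leaf_of_unique (hg i₁) hright
      refine ⟨a, b, ha, ha', hb, hb', ?_⟩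
      rintro rfl
      exact hst (eq_of_not_isCore ha ha'.symm hb'.symm)
  obtain ⟨a, b, ha, ha', hb, hb', hab⟩ := hab
  refine ⟨g i₀, g i₁, a, b, ⟨hg _, hg _, hleft, hright, heq, ?_, ?_, ?_, ha, hb, ha', hb', hab⟩⟩
  · intro p hp hps hpt
    obtain ⟨i, rfl⟩ := hsurj p hp
    have h0 : i.val ≠ 0 := fun h => hps (congrArg g (Fin.ext h))
    have h1 : i.val ≠ m - 1 := fun h => hpt (congrArg g (Fin.ext h))
    have := i.2
    refine ⟨g ⟨i.val - 1, by omega⟩, g ⟨i.val + 1, by omega⟩, ?_, hg _, hg _, ?_, ?_⟩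
    · intro h
      have := congrArg Fin.val (hinj h)
      simp at this
    · exact (hadj _ _).2 (Or.inr (Nat.sub_add_cancel (Nat.pos_of_ne_zero h0)))
    · exact (hadj _ _).2 (Or.inl rfl)
  · intro hst
    have := hlt hst
    exact ⟨g ⟨1, by omega⟩, hg _, by rw [hadj]; simp [i₀]⟩
  · intro hst
    have := hlt hst
    exact ⟨g ⟨m - 2, by omega⟩, hg _, by rw [hadj]; simp only [i₁]; omega⟩

theorem IsEnds.symm {T : SimpleGraph V} {s t a b : V} (h : IsEnds T s t a b) :
    IsEnds T t s b a where
  core_left := h.core_right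
  core_right := h.core_left
  left := h.right
  right := h.left
  eq_of_eq := fun e p hp => (h.eq_of_eq e.symm p hp).trans e.symm
  inner := fun p hp h₁ h₂ => h.inner p hp h₂ h₁
  exists_left := fun e => h.exists_right e.symm
  exists_right := fun e => h.exists_left e.symm
  leaf_left := h.leaf_right
  leaf_right := h.leaf_left
  adj_left := h.adj_right
  adj_right := h.adj_left
  ne := h.ne.symm

theorem IsEnds.exists_neighbors_left {T : SimpleGraph V} {s t a b : V} (h : IsEnds T s t a b) :
    ∃ q r, q ≠ r ∧ T.Adj s q ∧ T.Adj s r ∧ (IsCore T q ∨ q = a ∨ q = b) ∧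
      (IsCore T r ∨ r = a ∨ r = b) := by
  by_cases hst : s = t
  · exact ⟨a, b, h.ne, h.adj_left, hst ▸ h.adj_right, by simp, by simp⟩
  · obtain ⟨p, hp, hsp⟩ := h.exists_left hst
    exact ⟨a, p, fun e => h.leaf_left (e ▸ hp), h.adj_left, hsp, by simp, Or.inl hp⟩

/-- The two neighbours survive the deletion of any vertex outside the skeleton except `a` and `b`,
so `z` still has two neighbours in such a card. This is why `a` and `b` are excluded later. -/
theorem IsEnds.exists_neighbors {T : SimpleGraph V} {s t a b : V} (h : IsEnds T s t a b) {z : V}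
    (hz : IsCore T z) :
    ∃ q r, q ≠ r ∧ T.Adj z q ∧ T.Adj z r ∧ (IsCore T q ∨ q = a ∨ q = b) ∧
      (IsCore T r ∨ r = a ∨ r = b) := by
  by_cases hs : z = s
  · subst hs; exact h.exists_neighbors_left
  by_cases ht : z = t
  · subst ht
    obtain ⟨q, r, h1, h2, h3, h4, h5⟩ := h.symm.exists_neighbors_left
    exact ⟨q, r, h1, h2, h3, by tauto, by tauto⟩
  · obtain ⟨q, r, h1, h2, h3, h4, h5⟩ := h.inner z hz hs ht
    exact ⟨q, r, h1, h4, h5, Or.inl h2, Or.inl h3⟩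

end Caterpillar

/-! ### Local structure of a common card -/

section CommonCard

variable {V V' : Type u}

/-- Off the vertex `x`, the bijection `e` preserves and reflects adjacency. -/
def AgreesOff (U : SimpleGraph V) (T : SimpleGraph V') (x : V) (e : V ≃ V') : Prop :=
  ∀ a b, a ≠ x → b ≠ x → (U.Adj a b ↔ T.Adj (e a) (e b))

theorem exists_agreesOff {U : SimpleGraph V} {T : SimpleGraph V'} {x : V} {y : V'}
    (h : Nonempty (card U x ≃g card T y)) : ∃ e : V ≃ V', e x = y ∧ AgreesOff U T x e := by
  classical
  obtain ⟨f⟩ := h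
  let f' : {a // a ≠ x} ≃ {b // b ≠ y} := f.toEquiv
  let e : V ≃ V' := (Equiv.optionSubtypeNe x).symm.trans
    ((Equiv.optionCongr f').trans (Equiv.optionSubtypeNe y))
  have he : ∀ a (ha : a ≠ x), e a = f ⟨a, ha⟩ := fun a ha => by
    simp only [e, Equiv.trans_apply, Equiv.optionSubtypeNe_symm_of_ne ha]
    rfl
  refine ⟨e, ?_, fun a b ha hb => ?_⟩
  · simp only [e, Equiv.trans_apply, Equiv.optionSubtypeNe_symm_self]
    rfl
  · rw [he a ha, he b hb]
    exact (f.map_adj_iff (v := ⟨a, ha⟩) (w := ⟨b, hb⟩)).symm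

variable {U : SimpleGraph V} {T : SimpleGraph V'} {x : V} {e : V ≃ V'}

theorem AgreesOff.trans_iso (h : AgreesOff U T x e) (f : T ≃g T) :
    AgreesOff U T x (e.trans f.toEquiv) := fun a b ha hb =>
  (h a b ha hb).trans f.map_adj_iff.symm

/-- Otherwise the cycle of `U` would survive in the card and embed in `T`. -/
theorem AgreesOff.isCore_left [Finite V] [Finite V'] (h : AgreesOff U T x e)
    (hU : IsSunshine U) (hT : IsCaterpillar T) : IsCore U x := by
  by_contra hx
  obtain ⟨s, hs⟩ := hU.exists_isCore
  refine hT.not_two_neighbors (A := e '' {a | IsCore U a}) ⟨e s, s, hs, rfl⟩ ?_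
  rintro _ ⟨a, ha, rfl⟩
  obtain ⟨p, q, hpq, hp, hq, hap, haq, -⟩ := hU.exists_neighbors ha
  have hne : ∀ c, IsCore U c → c ≠ x := fun c hc hcx => hx (hcx ▸ hc)
  exact ⟨e p, ⟨p, hp, rfl⟩, e q, ⟨q, hq, rfl⟩, e.injective.ne hpq,
    (h a p (hne a ha) (hne p hp)).1 hap, (h a q (hne a ha) (hne q hq)).1 haq⟩

/-- A leaf at `x` becomes isolated in the card, so in the connected graph `T` its only neighbour is
the deleted vertex. -/
theorem AgreesOff.leaf_adj (h : AgreesOff U T x e) (hT : T.Connected)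
    (hT' : ∃ s, IsCore T s) {l : V} (hxl : U.Adj x l) (hl : ¬ IsCore U l) :
    T.Adj (e x) (e l) ∧ ¬ IsCore T (e l) := by
  have key : ∀ z, T.Adj (e l) z → z = e x := by
    intro z hz
    obtain ⟨c, rfl⟩ := e.surjective z
    by_contra hne
    have hcx : c ≠ x := fun hc => hne (hc ▸ rfl)
    exact hcx (eq_of_not_isCore hl ((h l c hxl.ne' hcx).2 hz) hxl.symm)
  obtain ⟨z, hz⟩ := exists_adj hT hT' (e l)
  refine ⟨(key z hz ▸ hz).symm, ?_⟩
  rintro ⟨b, c, hbc, hb, hc⟩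
  exact hbc ((key b hb).trans (key c hc).symm)

theorem card_edges_card [Fintype V] (G : SimpleGraph V) [DecidableRel G.Adj] (v : V) :
    Nat.card (card G v).edgeSet + G.degree v = Nat.card G.edgeSet := by
  classical
  have h1 := G.card_edgeFinset_induce_compl_singleton v
  rw [G.card_edgeFinset_deleteIncidenceSet v] at h1
  have h2 : G.degree v ≤ G.edgeFinset.card := by
    rw [← G.card_incidenceFinset_eq_degree]
    exact Finset.card_le_card (G.incidenceFinset_subset v)
  rw [SimpleGraph.edgeFinset_card, ← Nat.card_eq_fintype_card] at h1
  rw [SimpleGraph.edgeFinset_card, ← Nat.card_eq_fintype_card] at h1 h2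
  change Nat.card (card G v).edgeSet = _ at h1
  omega

/-- On equally many vertices `U` has more edges than the tree `T`, while the two cards have equally
many. -/
theorem degree_lt_degree_of_iso [Fintype V] [Fintype V'] [DecidableRel U.Adj]
    [DecidableRel T.Adj] {y : V'} (hU : IsSunshine U) (hT : IsCaterpillar T) (e : V ≃ V')
    (h : Nonempty (card U x ≃g card T y)) : T.degree y < U.degree x := by
  obtain ⟨f⟩ := h
  have h1 := card_edges_card U x
  have h2 := card_edges_card T y
  have h3 := hU.card_le_edges
  have h4 := hT.card_edges
  have h5 : Nat.card (card U x).edgeSet = Nat.card (card T y).edgeSet :=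
    Nat.card_congr f.mapEdgeSet
  have h6 := Nat.card_congr e
  omega

/-- All but two neighbours of `x` are leaves, and these become leaves at `e x`. An inner skeleton
vertex has two further neighbours in the skeleton, so its degree would be at least that of `x`. -/
theorem AgreesOff.not_isCore_right [Fintype V] [Fintype V'] (h : AgreesOff U T x e)
    (hU : IsSunshine U) (hT : IsCaterpillar T) {s t a b : V'} (hE : IsEnds T s t a b)
    (hlt : ∀ [DecidableRel U.Adj] [DecidableRel T.Adj], T.degree (e x) < U.degree x)
    (hs : e x ≠ s) (ht : e x ≠ t) : ¬ IsCore T (e x) := by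
  classical
  intro hy
  obtain ⟨q, r, hqr, hq, hr, hyq, hyr⟩ := hE.inner _ hy hs ht
  obtain ⟨p₁, p₂, hp, -, -, -, -, hp'⟩ := hU.exists_neighbors (h.isCore_left hU hT)
  have h1 : U.neighborFinset x ⊆ {p₁, p₂} ∪ (U.neighborFinset x).filter (¬ IsCore U ·) := by
    intro l hl
    by_cases hc : IsCore U l
    · have := hp' l hc (by simpa using hl)
      exact Finset.mem_union_left _ (by simpa using this)
    · simp only [Finset.mem_union, Finset.mem_filter]
      exact Or.inr ⟨hl, hc⟩
  have h2 : ((U.neighborFinset x).filter (¬ IsCore U ·)).image e ⊆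
      (T.neighborFinset (e x)) \ {q, r} := by
    intro z hz
    obtain ⟨l, hl, rfl⟩ := Finset.mem_image.1 hz
    rw [Finset.mem_filter, SimpleGraph.mem_neighborFinset] at hl
    have := h.leaf_adj hT.1 hT.exists_isCore hl.1 hl.2
    simp only [Finset.mem_sdiff, SimpleGraph.mem_neighborFinset, Finset.mem_insert,
      Finset.mem_singleton, not_or]
    exact ⟨this.1, fun e => this.2 (e ▸ hq), fun e => this.2 (e ▸ hr)⟩
  have h3 := (Finset.card_le_card h1).trans (Finset.card_union_le _ _)
  have h4 := Finset.card_le_card h2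
  rw [Finset.card_image_of_injective _ e.injective, Finset.card_sdiff_of_subset (by
    intro z hz
    simp only [Finset.mem_insert, Finset.mem_singleton] at hz
    rcases hz with rfl | rfl <;> simpa), Finset.card_pair hqr] at h4
  rw [Finset.card_pair hp] at h3
  have h5 : ({q, r} : Finset V').card ≤ (T.neighborFinset (e x)).card :=
    Finset.card_le_card (by
      intro z hz
      simp only [Finset.mem_insert, Finset.mem_singleton] at hz
      rcases hz with rfl | rfl <;> simpa)
  rw [Finset.card_pair hqr] at h5
  have h6 := hlt
  simp only [SimpleGraph.card_neighborFinset_eq_degree] at h3 h4 h5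
  omega

/-- A leaf at `x` would become a leaf of `T` adjacent to `e x`, which is itself outside the
skeleton. -/
theorem AgreesOff.exists_neighbors [Finite V] [Finite V'] (h : AgreesOff U T x e)
    (hU : IsSunshine U) (hT : IsCaterpillar T) (hy : ¬ IsCore T (e x)) :
    ∃ p q, p ≠ q ∧ ∀ r, U.Adj x r ↔ r = p ∨ r = q := by
  obtain ⟨p, q, hpq, -, -, hxp, hxq, hr⟩ := hU.exists_neighbors (h.isCore_left hU hT)
  refine ⟨p, q, hpq, fun r => ⟨fun hxr => hr r ?_ hxr, ?_⟩⟩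
  · by_contra hc
    have := h.leaf_adj hT.1 hT.exists_isCore hxr hc
    exact this.2 (isCore_of_adj hT.1 hT.exists_isCore hy this.1)
  · rintro (rfl | rfl) <;> assumption

end CommonCard

/-! ### Adding a vertex of degree two to the caterpillar -/

section Join

variable {V V' : Type u}

/-- The graph obtained from `T` by adding a vertex that is adjacent to `a` and `b`. -/
def join (T : SimpleGraph V') (a b : V') : SimpleGraph (Option V') where
  Adj
    | none, none => False
    | none, some c => c = a ∨ c = b
    | some c, none => c = a ∨ c = b
    | some c, some d => T.Adj c d
  symm := ⟨by rintro (_ | c) (_ | d) h <;> first | exact h | exact T.adj_symm h⟩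
  loopless := ⟨by rintro (_ | c) h; exacts [h, T.irrefl h]⟩

@[simp] theorem join_none_some {T : SimpleGraph V'} {a b c : V'} :
    (join T a b).Adj none (some c) ↔ c = a ∨ c = b := Iff.rfl

@[simp] theorem join_some_none {T : SimpleGraph V'} {a b c : V'} :
    (join T a b).Adj (some c) none ↔ c = a ∨ c = b := Iff.rfl

@[simp] theorem join_some_some {T : SimpleGraph V'} {a b c d : V'} :
    (join T a b).Adj (some c) (some d) ↔ T.Adj c d := Iff.rfl

@[simp] theorem join_none_none {T : SimpleGraph V'} {a b : V'} :
    ¬ (join T a b).Adj none none := id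

/-- Each of `a` and `b` has an old neighbour as well as the new one, so both enter the skeleton. -/
theorem isCore_join {T : SimpleGraph V'} (hT : T.Connected) (hT' : ∃ s, IsCore T s) {a b : V'}
    (hab : a ≠ b) :
    {c | IsCore (join T a b) c} = insert none (some '' ({c | IsCore T c} ∪ {a, b})) := by
  ext c
  cases c with
  | none =>
    simp only [Set.mem_ofPred_eq, Set.mem_insert_iff, true_or, iff_true]
    exact ⟨some a, some b, by simpa, by simp, by simp⟩
  | some c =>
    simp only [Set.mem_ofPred_eq, Set.mem_insert_iff, reduceCtorEq, Set.mem_image,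
      Option.some.injEq, exists_eq_right, false_or, Set.mem_union, Set.mem_singleton_iff]
    constructor
    · rintro ⟨p, q, hpq, hp, hq⟩
      cases p with
      | none => exact Or.inr hp
      | some p =>
        cases q with
        | none => exact Or.inr hq
        | some q => exact Or.inl ⟨p, q, fun e => hpq (e ▸ rfl), hp, hq⟩
    · rintro (⟨p, q, hpq, hp, hq⟩ | hc)
      · exact ⟨some p, some q, by simpa, hp, hq⟩
      · obtain ⟨z, hz⟩ := exists_adj hT hT' c
        exact ⟨none, some z, by simp, hc, hz⟩

theorem ncard_isCore_join [Finite V'] {T : SimpleGraph V'} (hT : T.Connected)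
    (hT' : ∃ s, IsCore T s) {a b : V'} (hab : a ≠ b) :
    {c | IsCore (join T a b) c}.ncard = ({c | IsCore T c} ∪ {a, b}).ncard + 1 := by
  rw [isCore_join hT hT' hab, Set.ncard_insert_of_notMem (by simp) (Set.toFinite _),
    Set.ncard_image_of_injective _ (Option.some_injective _)]

theorem nonempty_card_join_iso (T : SimpleGraph V') (a b : V') :
    Nonempty (card (join T a b) none ≃g T) := by
  classical
  refine IsCardEquiv.nonempty_iso (E := Equiv.refl _) ?_ rfl
  intro c d
  simp

open Classical in
/-- The bijection of `Option V` and `Option V'` that maps `some x` to `none`, and `none` to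
`some (e x)`, and is given by `e` elsewhere. -/
noncomputable def shiftEquiv (x : V) (e : V ≃ V') : Option V ≃ Option V' :=
  (Equiv.swap none (some x)).trans e.optionCongr

@[simp] theorem shiftEquiv_none (x : V) (e : V ≃ V') : shiftEquiv x e none = some (e x) := by
  simp [shiftEquiv]

@[simp] theorem shiftEquiv_self (x : V) (e : V ≃ V') : shiftEquiv x e (some x) = none := by
  simp [shiftEquiv]

theorem shiftEquiv_of_ne {x a : V} (e : V ≃ V') (h : a ≠ x) :
    shiftEquiv x e (some a) = some (e a) := by
  simp [shiftEquiv, Equiv.swap_apply_of_ne_of_ne, h]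

theorem AgreesOff.isCardEquiv {U : SimpleGraph V} {T : SimpleGraph V'} {x : V} {e : V ≃ V'}
    (h : AgreesOff U T x e) {p q : V} (hx : ∀ r, U.Adj x r ↔ r = p ∨ r = q) :
    IsCardEquiv U (join T (e p) (e q)) (shiftEquiv x e) := by
  intro a b
  by_cases ha : a = x
  · by_cases hb : b = x
    · subst ha hb; simp
    · subst ha
      rw [shiftEquiv_self, shiftEquiv_of_ne e hb, hx]
      simp
  · by_cases hb : b = x
    · subst hb
      rw [shiftEquiv_self, shiftEquiv_of_ne e ha, U.adj_comm, hx]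
      simp
    · rw [shiftEquiv_of_ne e ha, shiftEquiv_of_ne e hb, h a b ha hb]
      simp

end Join

/-! ### Adding a pendant vertex at a skeleton vertex -/

section Leaf

variable {V W : Type u}

/-- The pendant vertex is outside the skeleton, and its only neighbour `u` was in the skeleton
already. -/
theorem IsCardEquiv.isCore_eq {U : SimpleGraph V} {S : SimpleGraph W} {E : Option V ≃ W}
    (h : IsCardEquiv U S E) {u : V} (hu : ∀ a, S.Adj (E none) (E (some a)) ↔ a = u)
    (hc : IsCore U u) : {c | IsCore S c} = (fun a => E (some a)) '' {a | IsCore U a} := by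
  ext c
  constructor
  · rintro ⟨p, q, hpq, hp, hq⟩
    obtain ⟨c, rfl⟩ := E.surjective c
    obtain ⟨p, rfl⟩ := E.surjective p
    obtain ⟨q, rfl⟩ := E.surjective q
    cases c with
    | none =>
      cases p with
      | none => exact absurd hp (S.irrefl)
      | some p =>
        cases q with
        | none => exact absurd hq (S.irrefl)
        | some q => rw [hu] at hp hq; exact absurd (by rw [hp, hq]) hpq
    | some c =>
      refine ⟨c, ?_, rfl⟩
      cases p with
      | none => rw [S.adj_comm, hu] at hp; exact hp ▸ hc
      | some p =>
        cases q with
        | none => rw [S.adj_comm, hu] at hq; exact hq ▸ hc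
        | some q => exact ⟨p, q, fun e => hpq (e ▸ rfl), (h _ _).2 hp, (h _ _).2 hq⟩
  · rintro ⟨a, ⟨p, q, hpq, hp, hq⟩, rfl⟩
    exact ⟨E (some p), E (some q), by simpa, (h _ _).1 hp, (h _ _).1 hq⟩

theorem IsCardEquiv.isSunshine [Finite V] [Finite W] {U : SimpleGraph V} {S : SimpleGraph W}
    {E : Option V ≃ W}
    (h : IsCardEquiv U S E) {u : V} (hu : ∀ a, S.Adj (E none) (E (some a)) ↔ a = u)
    (hc : IsCore U u) (hU : IsSunshine U) : IsSunshine S := by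
  have hcore := h.isCore_eq hu hc
  obtain ⟨hconn, c, hc3, ⟨f⟩⟩ := hU
  have hmem : ∀ a, IsCore S (E (some a)) ↔ IsCore U a := fun a => by
    have := Set.ext_iff.1 hcore (E (some a))
    simpa using this
  refine ⟨?_, c, hc3, ?_⟩
  · have : Nonempty W := ⟨E none⟩
    rw [SimpleGraph.connected_iff_exists_forall_reachable]
    refine ⟨E (some u), fun w => ?_⟩
    obtain ⟨w, rfl⟩ := E.surjective w
    cases w with
    | none => exact ((hu u).2 rfl).symm.reachable
    | some w =>
      exact (hconn u w).map ⟨fun a => E (some a), fun hab => (h _ _).1 hab⟩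
  · let g : ↥({x | deg U x ≠ 0 ∧ deg U x ≠ 1} : Set V) →
        ↥({x | deg S x ≠ 0 ∧ deg S x ≠ 1} : Set W) :=
      fun a => ⟨E (some a), mem_skel_iff.2 ((hmem a).2 (mem_skel_iff.1 a.2))⟩
    have hg : Function.Bijective g := by
      constructor
      · intro a b hab
        have := congrArg Subtype.val hab
        exact Subtype.ext (by simpa [g] using this)
      · rintro ⟨b, hb⟩
        have : b ∈ {c | IsCore S c} := mem_skel_iff.1 hb
        rw [hcore] at this
        obtain ⟨a, ha, rfl⟩ := this
        exact ⟨⟨a, mem_skel_iff.2 ha⟩, rfl⟩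
    let G : skel U ≃g skel S := ⟨Equiv.ofBijective g hg, by
      intro a b
      exact (h a b).symm⟩
    exact ⟨G.symm.trans f⟩

theorem IsCardEquiv.ncard_isCore {U : SimpleGraph V} {S : SimpleGraph W} {E : Option V ≃ W}
    (h : IsCardEquiv U S E) {u : V} (hu : ∀ a, S.Adj (E none) (E (some a)) ↔ a = u)
    (hc : IsCore U u) : {c | IsCore S c}.ncard = {a | IsCore U a}.ncard := by
  rw [h.isCore_eq hu hc, Set.ncard_image_of_injective]
  intro a b hab
  simpa using hab

end Leaf

/-! ### Reduction to two joins and the final count -/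

section Aligned

variable {V V' : Type u}

/-- The common card `U - x ≅ T - y` extends to an isomorphism of `U` and the card at `y` of the
sunshine graph `join T A B` that maps `x` to the added vertex. -/
def Aligned (U : SimpleGraph V) (T : SimpleGraph V') (A B : V') (x : V) (y : V') : Prop :=
  IsSunshine (join T A B) ∧ ∃ E : Option V ≃ Option V',
    E none = some y ∧ E (some x) = none ∧ IsCardEquiv U (join T A B) E

/-- `z` is the vertex `s` or a leaf adjacent to `s`. -/
def IsNear (T : SimpleGraph V') (s z : V') : Prop :=
  z = s ∨ (¬ IsCore T z ∧ T.Adj s z)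

theorem IsCore.map_iso {T : SimpleGraph V'} {z : V'} (f : T ≃g T) (h : IsCore T z) :
    IsCore T (f z) := by
  obtain ⟨b, c, hbc, hb, hc⟩ := h
  exact ⟨f b, f c, f.injective.ne hbc, f.map_adj_iff.2 hb, f.map_adj_iff.2 hc⟩

theorem IsNear.map_iso {T : SimpleGraph V'} {s z : V'} (f : T ≃g T) (h : IsNear T s z) :
    IsNear T (f s) (f z) := by
  rcases h with rfl | ⟨h₁, h₂⟩
  · exact Or.inl rfl
  · refine Or.inr ⟨fun h => h₁ ?_, f.map_adj_iff.2 h₂⟩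
    simpa using h.map_iso f.symm

-- Leaves with the same neighbour are twins.
open Classical in
theorem exists_iso_eq_swap {T : SimpleGraph V'} {s c d : V'} (hc : ¬ IsCore T c)
    (hd : ¬ IsCore T d) (hsc : T.Adj s c) (hsd : T.Adj s d) :
    ∃ f : T ≃g T, ∀ z, f z = Equiv.swap c d z := by
  have hc' : ∀ z, T.Adj c z ↔ z = s := fun z =>
    ⟨fun h => eq_of_not_isCore hc h hsc.symm, fun h => h ▸ hsc.symm⟩
  have hd' : ∀ z, T.Adj d z ↔ z = s := fun z =>
    ⟨fun h => eq_of_not_isCore hd h hsd.symm, fun h => h ▸ hsd.symm⟩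
  have key : ∀ z w, T.Adj z w → T.Adj (Equiv.swap c d z) (Equiv.swap c d w) := by
    have hs : Equiv.swap c d s = s := Equiv.swap_apply_of_ne_of_ne hsc.ne hsd.ne
    have h1 : ∀ w, T.Adj c w → T.Adj (Equiv.swap c d c) (Equiv.swap c d w) := fun w h => by
      rw [(hc' w).1 h, hs, Equiv.swap_apply_left]; exact hsd.symm
    have h2 : ∀ w, T.Adj d w → T.Adj (Equiv.swap c d d) (Equiv.swap c d w) := fun w h => by
      rw [(hd' w).1 h, hs, Equiv.swap_apply_right]; exact hsc.symm
    intro z w h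
    by_cases hzc : z = c
    · subst hzc; exact h1 w h
    by_cases hzd : z = d
    · subst hzd; exact h2 w h
    by_cases hwc : w = c
    · subst hwc; exact (h1 z h.symm).symm
    by_cases hwd : w = d
    · subst hwd; exact (h2 z h.symm).symm
    rwa [Equiv.swap_apply_of_ne_of_ne hzc hzd, Equiv.swap_apply_of_ne_of_ne hwc hwd]
  refine ⟨⟨Equiv.swap c d, fun {z w} => ⟨fun h => ?_, key z w⟩⟩, fun z => rfl⟩
  simpa using key _ _ h

/-- Of two leaves at the same vertex, either can be moved to the other by an automorphism that fixes
all the remaining vertices. -/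
theorem IsNear.exists_iso {T : SimpleGraph V'} {s a c : V'} (h : IsNear T s c)
    (hs : IsCore T s) (ha : ¬ IsCore T a) (hsa : T.Adj s a) :
    ∃ f : T ≃g T, (f c = s ∨ f c = a) ∧ (∀ z, IsCore T z → f z = z) ∧
      ∀ z, z ≠ c → z ≠ a → f z = z := by
  classical
  rcases h with rfl | ⟨h₁, h₂⟩
  · exact ⟨SimpleGraph.Iso.refl, Or.inl rfl, fun _ _ => rfl, fun _ _ _ => rfl⟩
  · obtain ⟨f, hf⟩ := exists_iso_eq_swap h₁ ha h₂ hsa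
    refine ⟨f, Or.inr (by rw [hf, Equiv.swap_apply_left]), fun z hz => ?_, fun z hz hz' => ?_⟩
    · rw [hf, Equiv.swap_apply_of_ne_of_ne]
      · rintro rfl; exact h₁ hz
      · rintro rfl; exact ha hz
    · rw [hf, Equiv.swap_apply_of_ne_of_ne hz hz']

variable {U : SimpleGraph V} {T : SimpleGraph V'} {x : V} {e : V ≃ V'}

/-- Inside the join, `e x` is a pendant vertex attached to a skeleton vertex of the copy of `U`, so
the join inherits the cycle of `U`. The second conclusion computes the length of that cycle from
`T`. -/
theorem AgreesOff.aligned [Finite V] [Finite V'] (h : AgreesOff U T x e) (hU : IsSunshine U)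
    (hT : IsCaterpillar T) {s t a b : V'} (hE : IsEnds T s t a b) (hy : ¬ IsCore T (e x))
    (ha : e x ≠ a) (hb : e x ≠ b) {p q : V} (hpq : p ≠ q)
    (hx : ∀ r, U.Adj x r ↔ r = p ∨ r = q) :
    Aligned U T (e p) (e q) x (e x) ∧
      {c | IsCore U c}.ncard = ({c | IsCore T c} ∪ {e p, e q}).ncard + 1 := by
  have hE' := h.isCardEquiv hx
  obtain ⟨z, hz⟩ := exists_adj hT.1 hT.exists_isCore (e x)
  obtain ⟨u, rfl⟩ := e.surjective z
  have hux : u ≠ x := fun hux => T.irrefl (hux ▸ hz)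
  have hu : ∀ c, (join T (e p) (e q)).Adj (shiftEquiv x e none) (shiftEquiv x e (some c)) ↔
      c = u := by
    intro c
    rw [shiftEquiv_none]
    by_cases hc : c = x
    · subst hc
      have : ¬ (c = p ∨ c = q) := fun h => U.irrefl ((hx c).2 h)
      rw [shiftEquiv_self, join_some_none, e.apply_eq_iff_eq, e.apply_eq_iff_eq]
      exact ⟨fun h => absurd h this, fun h => absurd h.symm hux⟩
    · rw [shiftEquiv_of_ne e hc, join_some_some]
      exact ⟨fun h => e.injective (eq_of_not_isCore hy h hz), fun h => h ▸ hz⟩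
  have hcu : IsCore U u := by
    obtain ⟨q, r, hqr, hq, hr, hq', hr'⟩ :=
      hE.exists_neighbors (isCore_of_adj hT.1 hT.exists_isCore hy hz)
    obtain ⟨q, rfl⟩ := e.surjective q
    obtain ⟨r, rfl⟩ := e.surjective r
    have key : ∀ d, (IsCore T (e d) ∨ e d = a ∨ e d = b) → d ≠ x := by
      rintro d (hd | hd | hd) rfl
      · exact hy hd
      · exact ha hd
      · exact hb hd
    exact ⟨q, r, fun h => hqr (h ▸ rfl), (h u q hux (key q hq')).2 hq,
      (h u r hux (key r hr')).2 hr⟩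
  refine ⟨⟨hE'.isSunshine hu hcu hU, shiftEquiv x e, shiftEquiv_none x e, shiftEquiv_self x e,
    hE'⟩, ?_⟩
  rw [← hE'.ncard_isCore hu hcu,
    ncard_isCore_join hT.1 hT.exists_isCore (e.injective.ne hpq)]

/-- On the cycle of the join `s` needs two skeleton neighbours but has at most one in `T`. The other
is the added vertex, or a leaf at `s` that has become part of the skeleton as `c` or `d`. -/
theorem IsEnds.isNear_left [Finite V'] (hT : IsCaterpillar T) {s t a b c d : V'}
    (hE : IsEnds T s t a b) (hcd : c ≠ d) (hJ : IsSunshine (join T c d)) :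
    IsNear T s c ∨ IsNear T s d := by
  by_contra! hn
  have hsc : s ≠ c := fun h => hn.1 (Or.inl h.symm)
  have hsd : s ≠ d := fun h => hn.2 (Or.inl h.symm)
  have hset := isCore_join hT.1 hT.exists_isCore hcd
  have hmem : ∀ z, IsCore (join T c d) (some z) ↔ (IsCore T z ∨ z = c ∨ z = d) := fun z => by
    have := Set.ext_iff.1 hset (some z)
    simp only [Set.mem_ofPred_eq, Set.mem_insert_iff, reduceCtorEq, Set.mem_image,
      Option.some.injEq, exists_eq_right, false_or, Set.mem_union, Set.mem_singleton_iff] at this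
    exact this
  obtain ⟨p, q, hpq, hp, hq, hsp, hsq, -⟩ := hJ.exists_neighbors ((hmem s).2 (Or.inl hE.core_left))
  have key : ∀ z, IsCore (join T c d) z → (join T c d).Adj (some s) z →
      ∃ z', z = some z' ∧ IsCore T z' ∧ T.Adj s z' := by
    intro z hz hsz
    cases z with
    | none => exact absurd hsz (by simp [hsc, hsd])
    | some z =>
      refine ⟨z, rfl, ?_, hsz⟩
      by_contra hz'
      rcases (hmem z).1 hz with h | rfl | rfl
      · exact hz' h
      · exact hn.1 (Or.inr ⟨hz', hsz⟩)
      · exact hn.2 (Or.inr ⟨hz', hsz⟩)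
  obtain ⟨p, rfl, hp, hsp⟩ := key p hp hsp
  obtain ⟨q, rfl, hq, hsq⟩ := key q hq hsq
  exact hpq (congrArg some (hE.left p q hp hq hsp hsq))

/-- For `s ≠ t` no vertex is near both ends, so `c` and `d` serve different ends; for `s = t` every
vertex is near. -/
theorem IsEnds.isNear [Finite V'] (hT : IsCaterpillar T) {s t a b c d : V'}
    (hE : IsEnds T s t a b) (hcd : c ≠ d) (hJ : IsSunshine (join T c d)) :
    (IsNear T s c ∧ IsNear T t d) ∨ (IsNear T s d ∧ IsNear T t c) := by
  by_cases hst : s = t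
  · subst hst
    have key : ∀ z, IsNear T s z := fun z => by
      by_cases hz : IsCore T z
      · exact Or.inl (hE.eq_of_eq rfl z hz)
      · obtain ⟨w, hw⟩ := exists_adj hT.1 hT.exists_isCore z
        have := hE.eq_of_eq rfl w (isCore_of_adj hT.1 hT.exists_isCore hz hw)
        exact Or.inr ⟨hz, (this ▸ hw).symm⟩
    exact Or.inl ⟨key c, key d⟩
  · have hnot : ∀ z, IsNear T s z → IsNear T t z → False := by
      rintro z (rfl | ⟨h₁, h₂⟩) (h₃ | ⟨h₃, h₄⟩)
      · exact hst h₃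
      · exact h₃ hE.core_left
      · exact h₁ (h₃ ▸ hE.core_right)
      · exact hst (eq_of_not_isCore h₁ h₂.symm h₄.symm)
    have h₁ := hE.isNear_left hT hcd hJ
    have h₂ := hE.symm.isNear_left hT hcd hJ
    have := hnot c
    have := hnot d
    tauto

theorem AgreesOff.exists_aligned_of_isNear [Finite V] [Finite V'] (h : AgreesOff U T x e)
    (hU : IsSunshine U) (hT : IsCaterpillar T) {s t a b : V'} (hE : IsEnds T s t a b)
    (hy : ¬ IsCore T (e x)) (ha : e x ≠ a) (hb : e x ≠ b) {p q : V} (hpq : p ≠ q)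
    (hx : ∀ r, U.Adj x r ↔ r = p ∨ r = q) (hp : IsNear T s (e p)) (hq : IsNear T t (e q)) :
    ∃ A B, (A = s ∨ A = a) ∧ (B = t ∨ B = b) ∧ A ≠ B ∧ Aligned U T A B x (e x) ∧
      {c | IsCore U c}.ncard = ({c | IsCore T c} ∪ {A, B}).ncard + 1 := by
  have hxp : x ≠ p := fun hxp => U.irrefl ((hx x).2 (Or.inl hxp))
  have hxq : x ≠ q := fun hxq => U.irrefl ((hx x).2 (Or.inr hxq))
  obtain ⟨f, hf₁, hf₂, hf₃⟩ := hp.exists_iso hE.core_left hE.leaf_left hE.adj_left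
  have hq' : IsNear T t (f (e q)) := by
    have := hq.map_iso f
    rwa [hf₂ t hE.core_right] at this
  have hfx : f (e x) = e x := hf₃ _ (e.injective.ne hxp) ha
  -- The second swap must preserve what the first achieved: it fixes both the image of `p` and `e
  -- x`.
  obtain ⟨g, hg₁, hg₂, hg₃⟩ := hq'.exists_iso hE.core_right hE.leaf_right hE.adj_right
  have hgx : g (f (e x)) = e x := by
    rw [hg₃ _ (f.injective.ne (e.injective.ne hxq)) (by rw [hfx]; exact hb), hfx]
  have hgp : g (f (e p)) = f (e p) := by
    rcases hf₁ with h | h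
    · exact hg₂ _ (h ▸ hE.core_left)
    · exact hg₃ _ (f.injective.ne (e.injective.ne hpq)) (h ▸ hE.ne)
  have h' := (h.trans_iso f).trans_iso g
  have hx' : ((e.trans f.toEquiv).trans g.toEquiv) x = e x := hgx
  have := h'.aligned hU hT hE (hx' ▸ hy) (hx' ▸ ha) (hx' ▸ hb) hpq hx
  rw [hx'] at this
  refine ⟨g (f (e p)), g (f (e q)), by rwa [hgp], hg₁, ?_, this⟩
  exact g.injective.ne (f.injective.ne (e.injective.ne hpq))

theorem exists_aligned [Fintype V] [Fintype V'] {y : V'} (hU : IsSunshine U)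
    (hT : IsCaterpillar T) {s t a b : V'} (hE : IsEnds T s t a b)
    (h : Nonempty (card U x ≃g card T y)) (hs : y ≠ s) (ht : y ≠ t) (ha : y ≠ a) (hb : y ≠ b) :
    ∃ A B, (A = s ∨ A = a) ∧ (B = t ∨ B = b) ∧ A ≠ B ∧ Aligned U T A B x y ∧
      {c | IsCore U c}.ncard = ({c | IsCore T c} ∪ {A, B}).ncard + 1 := by
  obtain ⟨e, rfl, he⟩ := exists_agreesOff h
  have hy := he.not_isCore_right hU hT hE (degree_lt_degree_of_iso hU hT e h) hs ht
  obtain ⟨p, q, hpq, hx⟩ := he.exists_neighbors hU hT hy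
  have hal := (he.aligned hU hT hE hy ha hb hpq hx).1
  rcases hE.isNear hT (e.injective.ne hpq) hal.1 with ⟨h₁, h₂⟩ | ⟨h₁, h₂⟩
  · exact he.exists_aligned_of_isNear hU hT hE hy ha hb hpq hx h₁ h₂
  · exact he.exists_aligned_of_isNear hU hT hE hy ha hb hpq.symm
      (fun r => (hx r).trans or_comm) h₁ h₂

/-- Up to the choice of `y` among four vertices of `T`, all the common cards of `U` and `T` come from
two sunshine graphs. -/
theorem exists_two_joins [Fintype V] [Fintype V'] (hU : IsSunshine U)
    (hT : IsCaterpillar T) {s t a b : V'} (hE : IsEnds T s t a b) :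
    ∃ A B A' B', ∀ x y, Nonempty (card U x ≃g card T y) → y ≠ s → y ≠ t → y ≠ a → y ≠ b →
      Aligned U T A B x y ∨ Aligned U T A' B' x y := by
  have hst : ({c | IsCore T c} ∪ {s, t}).ncard = {c | IsCore T c}.ncard := by
    congr 1
    refine Set.union_eq_self_of_subset_right ?_
    rintro z (rfl | rfl)
    exacts [hE.core_left, hE.core_right]
  have hsb : ({c | IsCore T c} ∪ {s, b}).ncard = {c | IsCore T c}.ncard + 1 := by
    rw [← Set.ncard_insert_of_notMem (a := b) hE.leaf_right (Set.toFinite _)]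
    congr 1
    ext z
    have : z = s → IsCore T z := fun h => h ▸ hE.core_left
    simp; tauto
  have hat : ({c | IsCore T c} ∪ {a, t}).ncard = {c | IsCore T c}.ncard + 1 := by
    rw [← Set.ncard_insert_of_notMem (a := a) hE.leaf_left (Set.toFinite _)]
    congr 1
    ext z
    have : z = t → IsCore T z := fun h => h ▸ hE.core_right
    simp; tauto
  have hab : ({c | IsCore T c} ∪ {a, b}).ncard = {c | IsCore T c}.ncard + 2 := by
    rw [Set.ncard_union_eq _ (Set.toFinite _) (Set.toFinite _), Set.ncard_pair hE.ne]
    rw [Set.disjoint_right]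
    rintro z (rfl | rfl)
    exacts [hE.leaf_left, hE.leaf_right]
  -- The joins at `(s,t)`, `(s,b)`, `(a,t)`, `(a,b)` have cycles longer than the skeleton of `T` by
  -- 1, 2, 2, 3, so the cycle length of `U` selects one join, or the middle two.
  by_cases h0 : {c | IsCore U c}.ncard = {c | IsCore T c}.ncard + 1
  · refine ⟨s, t, s, t, fun x y h h1 h2 h3 h4 => ?_⟩
    obtain ⟨A, B, rfl | rfl, rfl | rfl, -, hA, hc⟩ := exists_aligned hU hT hE h h1 h2 h3 h4
    · exact Or.inl hA
    all_goals omega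
  by_cases h1 : {c | IsCore U c}.ncard = {c | IsCore T c}.ncard + 2
  · refine ⟨s, b, a, t, fun x y h h1 h2 h3 h4 => ?_⟩
    obtain ⟨A, B, rfl | rfl, rfl | rfl, -, hA, hc⟩ := exists_aligned hU hT hE h h1 h2 h3 h4
    · omega
    · exact Or.inl hA
    · exact Or.inr hA
    · omega
  · refine ⟨a, b, a, b, fun x y h h1 h2 h3 h4 => ?_⟩
    obtain ⟨A, B, rfl | rfl, rfl | rfl, -, hA, hc⟩ := exists_aligned hU hT hE h h1 h2 h3 h4
    · omega
    · omega
    · omega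
    · exact Or.inl hA

/-- All pairs live in the same supercard `join T A B`, with the added vertex as `v` and the `y` of
any one pair as `w`. -/
theorem card_le_of_aligned [Fintype V] [Fintype V'] {k : ℕ}
    (hmax : ∀ (W' : Type u) [Fintype W'] (S' : SimpleGraph W') (v' w' : W'),
      IsSunshine S' → IsSupercard S' v' w' U T → chi S' v' w' ≤ k)
    {A B : V'} {P : Finset (V × V')} (h₁ : Set.InjOn Prod.fst (P : Set (V × V')))
    (h₂ : Set.InjOn Prod.snd (P : Set (V × V'))) (hP : ∀ p ∈ P, Aligned U T A B p.1 p.2) :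
    P.card ≤ k := by
  classical
  rcases P.eq_empty_or_nonempty with rfl | ⟨p₀, hp₀⟩
  · simp
  let f : V × V' → V × Option V' := fun p => (p.1, some p.2)
  have hf : Function.Injective f := fun p q h => by
    simp only [f, Prod.mk.injEq, Option.some.injEq] at h
    exact Prod.ext h.1 h.2
  obtain ⟨hJ, E, hE₁, -, hE₃⟩ := hP p₀ hp₀
  have hchi := card_le_chi_of_isCardEquiv (U := U) (S := join T A B) (v := none) (P.image f)
    (by
      rw [Finset.coe_image]
      rintro _ ⟨p, hp, rfl⟩ _ ⟨q, hq, rfl⟩ h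
      exact congrArg f (h₁ hp hq h))
    (by
      rw [Finset.coe_image]
      rintro _ ⟨p, hp, rfl⟩ _ ⟨q, hq, rfl⟩ h
      exact congrArg f (h₂ hp hq (Option.some_injective _ h)))
    (by
      intro p hp
      obtain ⟨q, hq, rfl⟩ := Finset.mem_image.1 hp
      exact (hP q hq).2)
    (Finset.mem_image_of_mem f hp₀)
  rw [Finset.card_image_of_injective _ hf] at hchi
  exact hchi.trans (hmax _ _ _ _ hJ ⟨hE₃.nonempty_iso hE₁, nonempty_card_join_iso T A B⟩)

theorem commonCards_le [Fintype V] [Fintype V'] (hU : IsSunshine U) (hT : IsCaterpillar T) {k : ℕ}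
    (hmax : ∀ (W' : Type u) [Fintype W'] (S' : SimpleGraph W') (v' w' : W'),
      IsSunshine S' → IsSupercard S' v' w' U T → chi S' v' w' ≤ k) :
    commonCards U T ≤ 2 * k + 4 := by
  classical
  obtain ⟨s, t, a, b, hE⟩ := hT.exists_isEnds
  obtain ⟨A, B, A', B', hAB⟩ := exists_two_joins hU hT hE
  obtain ⟨M, hM, hM₁, hM₂, hM₃⟩ := exists_matching U T
  have hcover : M ⊆ M.filter (fun p => p.2 ∈ ({s, t, a, b} : Finset V')) ∪
      (M.filter (fun p => Aligned U T A B p.1 p.2) ∪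
        M.filter (fun p => Aligned U T A' B' p.1 p.2)) := by
    intro p hp
    have := hAB p.1 p.2 (hM₃ p hp)
    simp only [Finset.mem_union, Finset.mem_filter, hp, true_and, Finset.mem_insert,
      Finset.mem_singleton]
    tauto
  have hsub : ∀ (q : V × V' → Prop) [DecidablePred q], (↑(M.filter q) : Set (V × V')) ⊆ M :=
    fun q _ => Finset.coe_subset.2 (Finset.filter_subset q M)
  -- The additive constant 4 counts the exceptional `y`, each of which is used by at most one pair.
  have h₁ : (M.filter (fun p => p.2 ∈ ({s, t, a, b} : Finset V'))).card ≤ 4 :=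
    (Finset.card_le_card_of_injOn Prod.snd (fun p hp => (Finset.mem_filter.1 hp).2)
      (hM₂.mono (hsub _))).trans Finset.card_le_four
  have h₂ := card_le_of_aligned hmax (A := A) (B := B) (hM₁.mono (hsub _)) (hM₂.mono (hsub _))
    (fun p hp => (Finset.mem_filter.1 hp).2)
  have h₃ := card_le_of_aligned hmax (A := A') (B := B') (hM₁.mono (hsub _)) (hM₂.mono (hsub _))
    (fun p hp => (Finset.mem_filter.1 hp).2)
  have h₄ := (Finset.card_le_card hcover).trans
    ((Finset.card_union_le _ _).trans (Nat.add_le_add_left (Finset.card_union_le _ _) _))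
  omega

end Aligned

end Supercards

theorem mainTheorem3 {V V' W : Type u} [Fintype V] [Fintype V'] [Fintype W]
    (U : SimpleGraph V) (T : SimpleGraph V')
    (hU : Supercards.IsSunshine U) (hT : Supercards.IsCaterpillar T)
    (S : SimpleGraph W) (v w : W)
    (hS : Supercards.IsSunshine S) (hST : Supercards.IsSupercard S v w U T)
    (hmax : ∀ (W' : Type u) [Fintype W'] (S' : SimpleGraph W') (v' w' : W'),
      Supercards.IsSunshine S' → Supercards.IsSupercard S' v' w' U T →
        Supercards.chi S' v' w' ≤ Supercards.chi S v w) :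
    Supercards.commonCards U T ≤ 2 * Supercards.chi S v w + 5 :=
  (Supercards.commonCards_le hU hT hmax).trans (by omega)
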